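/- Let $k$ be an algebraically closed field. A *tensor category* over $k$ is a $k$-linear abelian rigid monoidal category whose tensor product is $k$-bilinear, whose unit object is simple, and which is locally finite (every object has finite length and all Hom spaces are finite dimensional over $k$). It is a *finite tensor category* if moreover it has enough projective objects and only finitely many isomorphism classes of simple objects, and a *fusion category* if it is a finite tensor category that is also semisimple (every object is a finite direct sum of simple objects). Let $G$ be a group with neutral element $e$. A *$G$-grading* on a tensor category $\mathcal C$ is a family of full subcategories $\mathcal C_g$ ($g\in G$), closed under isomorphisms, such that: every object $X$ of $\mathcal C$ is isomorphic to a direct sum $\bigoplus_{g\in G}X_g$ with $X_g\in\mathcal C_g$; $\operatorname{Hom}_{\mathcal C}(X,Y)=0$ for all $X\in\mathcal C_g$, $Y\in\mathcal C_h$ with $g\neq h$; and $\mathcal C_g\otimes\mathcal C_h\subseteq\mathcal C_{gh}$ for all $g,h\in G$. (Some of the $\mathcal C_g$ may be zero.) The neutral component $\mathcal D=\mathcal C_e$ contains the unit object and is considered with the $k$-linear abelian monoidal structure inherited from $\mathcal C$. **Corollary 3.5.** Suppose $G$ is a finite group. Let $\mathcal C$ be a $G$-graded tensor category over $k$ with neutral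 homogeneous component $\mathcal D$. Then $\mathcal C$ is a finite tensor category if and only if $\mathcal D$ is a finite tensor category, and $\mathcal C$ is a fusion category if and only if $\mathcal D$ is a fusion category. -/

import Mathlib

open CategoryTheory CategoryTheory.Limits CategoryTheory.MonoidalCategory

universe w v u

namespace TensorCat

/-- An object `X` of an abelian category has finite length if it admits a composition series: a
finite chain `0 = X₀ ⊂ X₁ ⊂ ⋯ ⊂ Xₙ = X` of subobjects in which no subobject lies strictly between
`Xᵢ` and `Xᵢ₊₁` (equivalently, every quotient `Xᵢ₊₁ / Xᵢ` is simple). -/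
def HasFiniteLength {C : Type u} [Category.{v} C] [Abelian C] (X : C) : Prop :=
  ∃ s : RelSeries {p : Subobject X × Subobject X | p.1 ⋖ p.2}, s.head = ⊥ ∧ s.last = ⊤

/-- A `k`-linear abelian category is locally finite if every object has finite length and all
spaces of morphisms are finite dimensional. -/
structure IsLocallyFinite (k : Type w) [Field k] (C : Type u) [Category.{v} C] [Abelian C]
    [Linear k C] : Prop where
  hasFiniteLength : ∀ X : C, HasFiniteLength X
  finiteDimensional_hom : ∀ X Y : C, FiniteDimensional k (X ⟶ Y)

/-- A `k`-linear abelian monoidal category is a tensor category if its tensor product is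
`k`-bilinear, it is rigid (every object has a left and a right dual), it is locally finite and its
unit object is simple. -/
class IsTensorCategory (k : Type w) [Field k] (C : Type u) [Category.{v} C] [Abelian C]
    [Linear k C] [MonoidalCategory C] : Prop where
  monoidalPreadditive : MonoidalPreadditive C
  monoidalLinear : MonoidalLinear k C
  rigid : Nonempty (RigidCategory C)
  isLocallyFinite : IsLocallyFinite k C
  simple_unit : Simple (𝟙_ C)

/-- There are, up to isomorphism, only finitely many simple objects. -/
def HasFinitelyManySimples (C : Type u) [Category.{v} C] [Abelian C] : Prop :=
  ∃ (n : ℕ) (S : Fin n → C), ∀ X : C, Simple X → ∃ i, Nonempty (X ≅ S i)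

/-- Every object is a finite direct sum of simple objects. In a category all of whose objects
have finite length only finite direct sums of simple objects can occur. -/
def IsSemisimple (C : Type u) [Category.{v} C] [Abelian C] : Prop :=
  ∀ X : C, ∃ (n : ℕ) (S : Fin n → C) (_ : HasBiproduct S),
    (∀ i, Simple (S i)) ∧ Nonempty (X ≅ ⨁ S)

/-- A finite tensor category: a tensor category with enough projective objects and finitely many
simple objects up to isomorphism. -/
structure IsFiniteTensorCategory (k : Type w) [Field k] (C : Type u) [Category.{v} C] [Abelian C]
    [Linear k C] [MonoidalCategory C] : Prop where
  isTensorCategory : IsTensorCategory k C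
  enoughProjectives : EnoughProjectives C
  hasFinitelyManySimples : HasFinitelyManySimples C

/-- A fusion category: a semisimple finite tensor category. -/
structure IsFusionCategory (k : Type w) [Field k] (C : Type u) [Category.{v} C] [Abelian C]
    [Linear k C] [MonoidalCategory C] : Prop where
  isFiniteTensorCategory : IsFiniteTensorCategory k C
  isSemisimple : IsSemisimple C

/-- A grading of the tensor category `C` over `k` by the group `G`: full (replete) subcategories
`C_g`, given by their objects, such that every object is a direct sum `⨁ g, X g` with `X g` in
`C_g`, there are no nonzero morphisms between `C_g` and `C_h` for `g ≠ h`, and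
`C_g ⊗ C_h ⊆ C_{g * h}`. The grading is not required to be faithful. -/
structure GroupGrading (k : Type*) [Field k] (C : Type u) [Category.{v} C] [Abelian C]
    [Linear k C] [MonoidalCategory C] [IsTensorCategory k C] (G : Type*) [Group G] where
  /-- `component g X` says that the object `X` belongs to the homogeneous component `C_g`. -/
  component : G → ObjectProperty C
  isClosedUnderIsomorphisms : ∀ g, (component g).IsClosedUnderIsomorphisms
  exists_decomposition : ∀ X : C, ∃ (Y : G → C) (_ : HasBiproduct Y),
    (∀ g, component g (Y g)) ∧ Nonempty (X ≅ ⨁ Y)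
  hom_eq_zero : ∀ {g h : G}, g ≠ h → ∀ {X Y : C}, component g X → component h Y →
    ∀ f : X ⟶ Y, f = 0
  tensor_mem : ∀ {g h : G} {X Y : C}, component g X → component h Y → component (g * h) (X ⊗ Y)

namespace GroupGrading

variable {k : Type*} [Field k] {C : Type u} [Category.{v} C] [Abelian C]
  [Linear k C] [MonoidalCategory C] [IsTensorCategory k C] {G : Type*} [Group G]
  (𝒢 : GroupGrading k C G)

instance (g : G) : (𝒢.component g).IsClosedUnderIsomorphisms := 𝒢.isClosedUnderIsomorphisms g

theorem mem_of_hom_from {g : G} {X : C}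
    (hX : ∀ h, h ≠ g → ∀ Z : C, 𝒢.component h Z → ∀ f : Z ⟶ X, f = 0) :
    𝒢.component g X := by
  classical
  obtain ⟨Y, _, hY, ⟨e⟩⟩ := 𝒢.exists_decomposition X
  have hz : ∀ h, h ≠ g → biproduct.ι Y h = 0 := fun h hh => by
    have := hX h hh _ (hY h) (biproduct.ι Y h ≫ e.inv)
    rw [← cancel_mono e.inv, this, zero_comp]
  refine (𝒢.component g).prop_of_iso ?_ (hY g)
  refine Iso.trans ⟨biproduct.ι Y g, biproduct.π Y g, by simp, ?_⟩ e.symm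
  refine biproduct.hom_ext' _ _ fun j => ?_
  by_cases hj : j = g
  · subst hj; simp
  · simp [hz j hj]

theorem mem_of_hom_to {g : G} {X : C}
    (hX : ∀ h, h ≠ g → ∀ Z : C, 𝒢.component h Z → ∀ f : X ⟶ Z, f = 0) :
    𝒢.component g X := by
  classical
  obtain ⟨Y, _, hY, ⟨e⟩⟩ := 𝒢.exists_decomposition X
  have hz : ∀ h, h ≠ g → biproduct.π Y h = 0 := fun h hh => by
    have := hX h hh _ (hY h) (e.hom ≫ biproduct.π Y h)
    rw [← cancel_epi e.hom, this, comp_zero]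
  refine (𝒢.component g).prop_of_iso ?_ (hY g)
  refine Iso.trans ⟨biproduct.ι Y g, biproduct.π Y g, by simp, ?_⟩ e.symm
  refine biproduct.hom_ext _ _ fun j => ?_
  by_cases hj : j = g
  · subst hj; simp
  · simp [hz j hj]

instance (g : G) : (𝒢.component g).IsClosedUnderSubobjects where
  prop_of_mono i _ hY := 𝒢.mem_of_hom_from fun h hh Z hZ f => by
    rw [← cancel_mono i, zero_comp]
    exact 𝒢.hom_eq_zero hh hZ hY _

instance (g : G) : (𝒢.component g).IsClosedUnderQuotients where
  prop_of_epi p _ hX := 𝒢.mem_of_hom_to fun h hh Z hZ f => by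
    rw [← cancel_epi p, comp_zero]
    exact 𝒢.hom_eq_zero hh.symm hX hZ _

instance (g : G) : (𝒢.component g).ContainsZero where
  exists_zero := by
    obtain ⟨Z, hZ⟩ := HasZeroObject.zero (C := C)
    exact ⟨Z, hZ, 𝒢.mem_of_hom_from fun _ _ _ _ f => hZ.eq_of_tgt f 0⟩

instance (g : G) (J : Type*) [Category J] : (𝒢.component g).IsClosedUnderLimitsOfShape J where
  limitsOfShape_le := by
    rintro X ⟨p⟩
    refine 𝒢.mem_of_hom_from fun h hh Z hZ f => p.isLimit.hom_ext fun j => ?_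
    exact (𝒢.hom_eq_zero hh hZ (p.prop_diag_obj j) _).trans
      (𝒢.hom_eq_zero hh hZ (p.prop_diag_obj j) _).symm

instance (g : G) : (𝒢.component g).IsClosedUnderFiniteProducts where

/-- The unit object lies in the component of the neutral element. -/
theorem unit_mem : 𝒢.component 1 (𝟙_ C) := by
  have := IsTensorCategory.simple_unit k (C := C)
  obtain ⟨Y, _, hY, ⟨e⟩⟩ := 𝒢.exists_decomposition (𝟙_ C)
  obtain ⟨g, hg⟩ : ∃ g, biproduct.ι Y g ≫ e.inv ≠ 0 := by
    by_contra! hall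
    have h0 : e.inv = 0 := biproduct.hom_ext' _ _ fun j => by rw [hall j, comp_zero]
    exact id_nonzero (𝟙_ C) (by rw [← e.hom_inv_id, h0, comp_zero])
  have := isIso_of_mono_of_nonzero hg
  have hu : 𝒢.component g (𝟙_ C) :=
    (𝒢.component g).prop_of_iso (asIso (biproduct.ι Y g ≫ e.inv)) (hY g)
  have huu : 𝒢.component (g * g) (𝟙_ C) :=
    (𝒢.component (g * g)).prop_of_iso (λ_ (𝟙_ C)) (𝒢.tensor_mem hu hu)
  have hgg : g * g = g := by
    by_contra hne
    exact id_nonzero (𝟙_ C) (𝒢.hom_eq_zero hne huu hu _)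
  rwa [mul_eq_left.mp hgg] at hu

instance : (𝒢.component 1).IsMonoidal where
  prop_unit := 𝒢.unit_mem
  prop_tensor _ _ h₁ h₂ := by simpa using 𝒢.tensor_mem h₁ h₂

/-- The neutral homogeneous component `C_e`, as a full subcategory of `C` with the `k`-linear
abelian monoidal structure inherited from `C`. -/
abbrev NeutralComponent : Type u := (𝒢.component 1).FullSubcategory

end GroupGrading

end TensorCat

/-! Rigidity reduces the homological conditions to the unit, which lies in degree `1`. Tensoring on
the right with `X` has an exact right adjoint, tensoring with `Xᘁ`, so it preserves projectives and
epimorphisms. A projective cover of the unit by `P` therefore yields a cover of every `X` by the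
projective `P ⊗ X`. Degree-`1` objects are projective in the neutral component exactly when they are
in `C` (`projective_obj_iff`), so enough projectives pass both ways. With enough projectives,
semisimplicity is equivalent to projectivity of the unit, so it transfers too.

For simple objects, each one is homogeneous, so with `G` finite it suffices to bound each component.
Fix a simple `X` in degree `g`. Any simple `Y` of degree `g` is a quotient of `T ⊗ X` for some
simple `T` of degree `1`. Only finitely many `T` occur, and each `T ⊗ X`, having finite length, has
finitely many simple quotients. -/

namespace TensorCat

/-! ### Finite length, simple quotients and semisimplicity in abelian categories -/

section Abelian

variable {C : Type u} [Category.{v} C] [Abelian C]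

/-- The subquotient attached to a covering pair of subobjects is simple. -/
theorem simple_cokernel_of_covBy {X : C} {p q : Subobject X} (h : p ⋖ q) :
    Simple (cokernel (Subobject.ofLE p q h.le)) := by
  suffices ∀ i : (p : C) ⟶ (q : C), i ≫ q.arrow = p.arrow → Simple (cokernel i) from
    this _ (Subobject.ofLE_arrow _)
  refine fun i hi => ⟨fun {Z} g _ => ?_⟩
  have : Mono i := by
    have : Mono (i ≫ q.arrow) := by rw [hi]; infer_instance
    exact mono_of_mono i q.arrow
  constructor
  · rintro hg rfl
    have h0 : cokernel.π i = 0 := by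
      rw [← Category.comp_id (cokernel.π i), ← IsIso.inv_hom_id (0 : Z ⟶ cokernel i), comp_zero,
        comp_zero]
    have : Epi i := Preadditive.epi_of_cokernel_zero h0
    have : IsIso i := isIso_of_mono_of_epi i
    refine h.lt.not_ge (Subobject.le_of_comm (inv i) ?_)
    rw [IsIso.inv_comp_eq, hi]
  · intro hg
    -- The preimage in `q` of the subobject `Z` of the cokernel lies between `p` and `q`. If it is
    -- `p`, then `g = 0`; if it is `q`, then `g` is epi.
    let r := pullback.fst (cokernel.π i) g
    have : Mono r := inferInstanceAs (Mono (pullback.fst (cokernel.π i) g))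
    have : Mono (r ≫ q.arrow) := mono_comp _ _
    have hrq : Subobject.mk (r ≫ q.arrow) ≤ q := Subobject.mk_le_of_comm r rfl
    have hpr : p ≤ Subobject.mk (r ≫ q.arrow) :=
      Subobject.le_mk_of_comm (pullback.lift i 0 (by simp)) ((pullback.lift_fst_assoc ..).trans hi)
    have hw : r ≫ cokernel.π i = pullback.snd (cokernel.π i) g ≫ g := pullback.condition
    rcases h.eq_or_eq hpr hrq with hr | hr
    · exfalso
      apply hg
      obtain ⟨t, ht⟩ : ∃ t, t ≫ i = r := by
        refine ⟨Subobject.ofMkLE (r ≫ q.arrow) p hr.le, ?_⟩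
        rw [← cancel_mono q.arrow, Category.assoc, hi,
          Subobject.ofMkLE_arrow]
      rw [← ht, Category.assoc, cokernel.condition, comp_zero] at hw
      rw [← cancel_epi (pullback.snd (cokernel.π i) g), ← hw, comp_zero]
    · obtain ⟨t, ht⟩ : ∃ t, t ≫ r = 𝟙 _ := by
        refine ⟨Subobject.ofLEMk q (r ≫ q.arrow) hr.ge, ?_⟩
        rw [← cancel_mono q.arrow, Category.assoc, Subobject.ofLEMk_comp, Category.id_comp]
      have : Epi g := by
        have h2 : (t ≫ pullback.snd (cokernel.π i) g) ≫ g = cokernel.π i := by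
          rw [Category.assoc, ← hw, reassoc_of% ht]
        have : Epi ((t ≫ pullback.snd (cokernel.π i) g) ≫ g) := by rw [h2]; infer_instance
        exact epi_of_epi (t ≫ pullback.snd (cokernel.π i) g) g
      exact isIso_of_mono_of_epi g

/-- Induction on the length of an object. -/
theorem HasFiniteLength.induction {P : ObjectProperty C} [P.IsClosedUnderIsomorphisms]
    (zero : ∀ X, IsZero X → P X)
    (extension : ∀ {A B : C} (f : A ⟶ B) [Mono f], Simple (cokernel f) → P A → P B)
    {X : C} (hX : HasFiniteLength X) : P X := by
  obtain ⟨s, hs, hs'⟩ := hX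
  have key : ∀ i, P (s i : C) := by
    intro i
    induction i using Fin.induction with
    | zero =>
      refine P.prop_of_iso ?_ (zero _ (isZero_zero C))
      exact Subobject.botCoeIsoZero.symm ≪≫ Subobject.isoOfEq _ _ hs.symm
    | succ i ih =>
      exact extension (Subobject.ofLE _ _ (CovBy.le (s.step i)))
        (simple_cokernel_of_covBy (s.step i)) ih
  have := key (Fin.last _)
  exact P.prop_of_iso (Subobject.isoOfEq _ _ hs' ≪≫ asIso (⊤ : Subobject X).arrow) this

/-- An object of finite length has only finitely many simple quotients up to isomorphism. -/
theorem HasFiniteLength.exists_list_simple_quotients {X : C} (hX : HasFiniteLength X) :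
    ∃ l : List C, ∀ (Y : C) (f : X ⟶ Y), Simple Y → f ≠ 0 → ∃ S ∈ l, Nonempty (Y ≅ S) := by
  let P : ObjectProperty C := fun X =>
    ∃ l : List C, ∀ (Y : C) (f : X ⟶ Y), Simple Y → f ≠ 0 → ∃ S ∈ l, Nonempty (Y ≅ S)
  have : P.IsClosedUnderIsomorphisms := ⟨fun {A B} e ⟨l, hl⟩ => ⟨l, fun Y f hY hf =>
    hl Y (e.hom ≫ f) hY fun h => hf (by rwa [Preadditive.IsIso.comp_left_eq_zero] at h)⟩⟩
  refine hX.induction (P := P) (fun X h => ⟨[], fun Y f _ hf => (hf (h.eq_of_src _ _)).elim⟩) ?_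
  rintro A B f _ hf ⟨l, hl⟩
  refine ⟨cokernel f :: l, fun Y g hY hg => ?_⟩
  -- Either `g` kills `A` and factors through the simple cokernel, where Schur's lemma applies, or
  -- it restricts to a nonzero map on `A`.
  by_cases h : f ≫ g = 0
  · refine ⟨_, List.mem_cons_self, ⟨?_⟩⟩
    have h0 : cokernel.desc f g h ≠ 0 := fun h' => hg (by
      rw [← cokernel.π_desc f g h, h', comp_zero])
    have := isIso_of_hom_simple h0
    exact (asIso (cokernel.desc f g h)).symm
  · obtain ⟨S, hS, e⟩ := hl Y _ hY h
    exact ⟨S, List.mem_cons_of_mem _ hS, e⟩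

theorem HasFiniteLength.exists_simple_mono {X : C} (hX : HasFiniteLength X) (h0 : ¬ IsZero X) :
    ∃ (S : C) (f : S ⟶ X), Simple S ∧ Mono f := by
  let P : ObjectProperty C := fun X => ¬ IsZero X → ∃ (S : C) (f : S ⟶ X), Simple S ∧ Mono f
  have : P.IsClosedUnderIsomorphisms := ⟨fun {A B} e h hB => by
    obtain ⟨S, f, hS, _⟩ := h fun hA => hB (hA.of_iso e.symm)
    exact ⟨S, f ≫ e.hom, hS, inferInstance⟩⟩
  refine hX.induction (P := P) (fun X h h' => (h' h).elim) ?_ h0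
  intro A B f _ hf ih hB
  by_cases hA : IsZero A
  · have hf0 : f = 0 := hA.eq_of_src _ _
    have : IsIso (cokernel.π f) := by
      have : Mono (cokernel.π f) := Preadditive.mono_of_cancel_zero _ fun g hg => by
        obtain ⟨t, ht⟩ := Abelian.monoLift f g hg, Abelian.monoLift_comp f g hg
        rw [← ht, hf0, comp_zero]
      exact isIso_of_mono_of_epi _
    exact ⟨_, inv (cokernel.π f), hf, inferInstance⟩
  · obtain ⟨S, g, hS, _⟩ := ih hA
    exact ⟨S, g ≫ f, hS, mono_comp g f⟩

/-- If all objects are projective and of finite length, the category is semisimple. -/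
theorem isSemisimple_of_projective (hC : ∀ X : C, HasFiniteLength X)
    (hP : ∀ X : C, Projective X) : IsSemisimple C := by
  intro X
  have := HasFiniteBiproducts.of_hasFiniteProducts (C := C)
  let P : ObjectProperty C := fun X => ∃ (n : ℕ) (S : Fin n → C) (_ : HasBiproduct S),
    (∀ i, Simple (S i)) ∧ Nonempty (X ≅ ⨁ S)
  have : P.IsClosedUnderIsomorphisms := ⟨fun {A B} e ⟨n, S, h, hS, ⟨e'⟩⟩ =>
    ⟨n, S, h, hS, ⟨e.symm ≪≫ e'⟩⟩⟩
  refine (hC X).induction (P := P) (fun X h => ⟨0, Fin.elim0, inferInstance, fun i => i.elim0,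
    ⟨h.iso ((IsZero.iff_id_eq_zero _).mpr (biproduct.hom_ext _ _ fun i => i.elim0))⟩⟩) ?_
  rintro A B f _ hf ⟨n, S, _, hS, ⟨e⟩⟩
  have := hP (cokernel f)
  -- Projectivity of the cokernel splits the extension, so `B` acquires one simple summand more than
  -- `A`.
  let T : ShortComplex C := ShortComplex.mk f (cokernel.π f) (cokernel.condition f)
  let σ : T.Splitting := ShortComplex.Splitting.ofExactOfSection T
    (ShortComplex.exact_cokernel f) (Projective.factorThru (𝟙 _) (cokernel.π f))
    (Projective.factorThru_comp _ _) inferInstance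
  have h1 : f ≫ σ.r = 𝟙 A := σ.f_r
  have h2 : σ.s ≫ cokernel.π f = 𝟙 _ := σ.s_g
  have h3 : σ.r ≫ f + cokernel.π f ≫ σ.s = 𝟙 B := σ.id
  have h4 : σ.s ≫ σ.r = 0 := σ.s_r
  let S' : Fin (n + 1) → C := Fin.cons (cokernel f) S
  let p : ∀ i, B ⟶ S' i := Fin.cases (cokernel.π f) fun i => σ.r ≫ e.hom ≫ biproduct.π S i
  let j : ∀ i, S' i ⟶ B := Fin.cases σ.s fun i => biproduct.ι S i ≫ e.inv ≫ f
  refine ⟨n + 1, S', inferInstance, Fin.cases hf hS, ⟨⟨biproduct.lift p, biproduct.desc j, ?_, ?_⟩⟩⟩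
  · rw [biproduct.lift_desc, Fin.sum_univ_succ, ← h3, add_comm]
    congr 1
    have : (𝟙 (⨁ S)) = ∑ i, biproduct.π S i ≫ biproduct.ι S i := by
      rw [← biproduct.total]
    have h5 : σ.r ≫ (e.hom ≫ 𝟙 (⨁ S) ≫ e.inv) ≫ f = σ.r ≫ f := by simp
    rw [← h5, this]
    simp only [Preadditive.sum_comp, Preadditive.comp_sum]
    refine Finset.sum_congr rfl fun i _ => ?_
    change (σ.r ≫ e.hom ≫ biproduct.π S i) ≫ biproduct.ι S i ≫ e.inv ≫ f = _
    simp
  · have hjp : ∀ a b, j a ≫ p b = biproduct.ι S' a ≫ biproduct.π S' b := by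
      intro a b
      induction a using Fin.cases with
      | zero =>
        induction b using Fin.cases with
        | zero => rw [biproduct.ι_π_self]; exact h2
        | succ b =>
          rw [biproduct.ι_π_ne _ (Fin.succ_ne_zero b).symm]
          change σ.s ≫ σ.r ≫ e.hom ≫ biproduct.π S b = 0
          rw [← Category.assoc, h4, zero_comp]
      | succ a =>
        induction b using Fin.cases with
        | zero =>
          rw [biproduct.ι_π_ne _ (Fin.succ_ne_zero a)]
          change (biproduct.ι S a ≫ e.inv ≫ f) ≫ cokernel.π f = 0
          simp
        | succ b =>
          have : j a.succ ≫ p b.succ = biproduct.ι S a ≫ biproduct.π S b := by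
            change (biproduct.ι S a ≫ e.inv ≫ f) ≫ σ.r ≫ e.hom ≫ biproduct.π S b = _
            simp [reassoc_of% h1]
          rw [this]
          by_cases hab : a = b
          · subst hab
            rw [biproduct.ι_π_self, biproduct.ι_π_self]; rfl
          · rw [biproduct.ι_π_ne _ hab, biproduct.ι_π_ne _ (by simpa using hab)]; rfl
    refine biproduct.hom_ext' _ _ fun a => biproduct.hom_ext _ _ fun b => ?_
    simpa using hjp a b

theorem hasFinitelyManySimples_of_list (l : List C)
    (hl : ∀ X : C, Simple X → ∃ S ∈ l, Nonempty (X ≅ S)) : HasFinitelyManySimples C :=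
  ⟨l.length, l.get, fun X hX => by
    obtain ⟨S, hS, e⟩ := hl X hX
    obtain ⟨i, rfl⟩ := List.mem_iff_get.mp hS
    exact ⟨i, e⟩⟩

/-- A projective cover of `X` is nonzero on some simple summand. By Schur's lemma that summand maps
isomorphically to `X`, which makes `X` a retract of a projective. -/
theorem IsSemisimple.projective_of_simple [EnoughProjectives C] (h : IsSemisimple C) (X : C)
    [Simple X] : Projective X := by
  obtain ⟨n, S, _, hS, ⟨e⟩⟩ := h (Projective.over X)
  obtain ⟨i, hi⟩ : ∃ i, biproduct.ι S i ≫ e.inv ≫ Projective.π X ≠ 0 := by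
    by_contra! hall
    have h0 : e.inv ≫ Projective.π X = 0 := biproduct.hom_ext' _ _ fun j => by rw [hall j, comp_zero]
    rw [Preadditive.IsIso.comp_left_eq_zero] at h0
    exact id_nonzero X (by rw [← cancel_epi (Projective.π X), h0, zero_comp, zero_comp])
  have := hS i
  have := isIso_of_hom_simple hi
  let r : Retract X (Projective.over X) :=
    { i := inv (biproduct.ι S i ≫ e.inv ≫ Projective.π X) ≫ biproduct.ι S i ≫ e.inv
      r := Projective.π X
      retract := by simp only [Category.assoc]; exact IsIso.inv_hom_id _ }
  exact r.projective

end Abelian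


/-! ### Projectivity and duals in rigid categories -/

section Tensor

variable {C : Type u} [Category.{v} C] [MonoidalCategory C]

theorem projective_tensor [RightRigidCategory C] (P X : C) [hP : Projective P] :
    Projective (P ⊗ X) := by
  -- The right adjoint `tensorRight Xᘁ` is itself a left adjoint, hence preserves epimorphisms.
  have := (tensorRightAdjunction Xᘁ Xᘁᘁ).isLeftAdjoint
  exact (tensorRightAdjunction X Xᘁ).map_projective P hP

theorem epi_whiskerRight [RightRigidCategory C] {A B : C} (f : A ⟶ B) [Epi f] (X : C) :
    Epi (f ▷ X) := by
  have := (tensorRightAdjunction X Xᘁ).isLeftAdjoint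
  exact inferInstanceAs (Epi ((tensorRight X).map f))

/-- If the unit is a quotient of a projective object, there are enough projective objects. -/
theorem enoughProjectives_of_epi_unit [RightRigidCategory C] {P : C} [Projective P]
    (f : P ⟶ 𝟙_ C) [Epi f] : EnoughProjectives C where
  presentation X := by
    have := epi_whiskerRight f X
    exact ⟨{ p := P ⊗ X
             projective := projective_tensor P X
             f := f ▷ X ≫ (λ_ X).hom
             epi := epi_comp _ _ }⟩

theorem projective_of_projective_unit [RightRigidCategory C] [Projective (𝟙_ C)] (X : C) :
    Projective X :=
  Projective.of_iso (λ_ X) (projective_tensor (𝟙_ C) X)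

theorem epi_whiskerLeft [LeftRigidCategory C] {A B : C} (f : A ⟶ B) [Epi f] (X : C) :
    Epi (X ◁ f) := by
  have := (tensorLeftAdjunction (ᘁX) X).isLeftAdjoint
  exact inferInstanceAs (Epi ((tensorLeft X).map f))

/-- For nonzero `X` the evaluation is nonzero by a triangle identity, hence epi onto the simple
unit. Tensoring with `Y` exhibits `Y` as a quotient of `(Y ⊗ Xᘁ) ⊗ X`. -/
theorem isZero_of_isZero_tensor_rightDual [Abelian C] [RigidCategory C]
    [MonoidalPreadditive C]
    [Simple (𝟙_ C)] {X Y : C} (hX : ¬ IsZero X) (h : IsZero (Y ⊗ Xᘁ)) : IsZero Y := by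
  have hε : ε_ X Xᘁ ≠ 0 := fun h0 => hX ((IsZero.iff_id_eq_zero X).mpr (by
    have := ExactPairing.evaluation_coevaluation X Xᘁ
    rw [h0] at this
    have h1 : (λ_ X).hom ≫ (ρ_ X).inv = 0 := by simpa using this.symm
    rw [← cancel_epi (λ_ X).hom, ← cancel_mono (ρ_ X).inv]
    simpa using h1))
  have : Epi (ε_ X Xᘁ) := epi_of_nonzero_to_simple hε
  have := epi_whiskerLeft (ε_ X Xᘁ) Y
  let p : (Y ⊗ Xᘁ) ⊗ X ⟶ Y := (α_ Y Xᘁ X).hom ≫ Y ◁ ε_ X Xᘁ ≫ (ρ_ Y).hom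
  have : Epi p := inferInstanceAs (Epi ((α_ Y Xᘁ X).hom ≫ Y ◁ ε_ X Xᘁ ≫ (ρ_ Y).hom))
  have hW : IsZero ((Y ⊗ Xᘁ) ⊗ X) := by
    rw [IsZero.iff_id_eq_zero, ← id_whiskerRight, (IsZero.iff_id_eq_zero _).mp h,
      MonoidalPreadditive.zero_whiskerRight]
  exact hW.of_epi p

/-- A tensor category with enough projectives is semisimple if and only if its unit is projective. -/
theorem IsTensorCategory.isSemisimple_iff (k : Type*) [Field k] [Abelian C] [Linear k C]
    [h : IsTensorCategory k C] [EnoughProjectives C] :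
    IsSemisimple C ↔ Projective (𝟙_ C) := by
  have := h.simple_unit
  obtain ⟨_⟩ := h.rigid
  exact ⟨fun hC => hC.projective_of_simple _, fun _ =>
    isSemisimple_of_projective h.isLocallyFinite.hasFiniteLength projective_of_projective_unit⟩

end Tensor


/-! ### Degrees of duals and of simple objects -/

namespace GroupGrading

variable {k : Type*} [Field k] {C : Type u} [Category.{v} C] [Abelian C]
  [Linear k C] [MonoidalCategory C] [IsTensorCategory k C] {G : Type*} [Group G]
  (𝒢 : GroupGrading k C G)

/-- Maps `Z ⟶ Y` correspond to maps `Z ⊗ X ⟶ 𝟙_ C`, which vanish unless the degree of `Z` is `g⁻¹`.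
-/
theorem prop_of_exactPairing_left {g : G} {X Y : C} [ExactPairing X Y]
    (hX : 𝒢.component g X) : 𝒢.component g⁻¹ Y := by
  refine 𝒢.mem_of_hom_from fun h hh Z hZ f => ?_
  have hne : h * g ≠ 1 := fun h' => hh (eq_inv_of_mul_eq_one_left h')
  have : Subsingleton (Z ⊗ X ⟶ 𝟙_ C) := ⟨fun a b =>
    (𝒢.hom_eq_zero hne (𝒢.tensor_mem hZ hX) 𝒢.unit_mem a).trans
      (𝒢.hom_eq_zero hne (𝒢.tensor_mem hZ hX) 𝒢.unit_mem b).symm⟩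
  have := (tensorRightHomEquiv Z X Y (𝟙_ C)).symm.subsingleton
  rw [← cancel_mono (λ_ Y).inv]
  exact Subsingleton.elim _ _

theorem prop_of_exactPairing_right {g : G} {X Y : C} [ExactPairing X Y]
    (hY : 𝒢.component g Y) : 𝒢.component g⁻¹ X := by
  refine 𝒢.mem_of_hom_from fun h hh Z hZ f => ?_
  have hne : g * h ≠ 1 := fun h' => hh (eq_inv_of_mul_eq_one_right h')
  have : Subsingleton (Y ⊗ Z ⟶ 𝟙_ C) := ⟨fun a b =>
    (𝒢.hom_eq_zero hne (𝒢.tensor_mem hY hZ) 𝒢.unit_mem a).trans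
      (𝒢.hom_eq_zero hne (𝒢.tensor_mem hY hZ) 𝒢.unit_mem b).symm⟩
  have := (tensorLeftHomEquiv Z X Y (𝟙_ C)).symm.subsingleton
  rw [← cancel_mono (ρ_ X).inv]
  exact Subsingleton.elim _ _

/-- Every simple object is homogeneous. -/
theorem exists_component_of_simple (X : C) [Simple X] : ∃ g, 𝒢.component g X := by
  obtain ⟨Y, _, hY, ⟨e⟩⟩ := 𝒢.exists_decomposition X
  obtain ⟨g, hg⟩ : ∃ g, biproduct.ι Y g ≫ e.inv ≠ 0 := by
    by_contra! hall
    have h0 : e.inv = 0 := biproduct.hom_ext' _ _ fun j => by rw [hall j, comp_zero]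
    exact id_nonzero X (by rw [← e.hom_inv_id, h0, comp_zero])
  have := isIso_of_mono_of_nonzero hg
  exact ⟨g, (𝒢.component g).prop_of_iso (asIso (biproduct.ι Y g ≫ e.inv)) (hY g)⟩

/-! ### The neutral component as a tensor category -/

instance : (𝒢.component 1).ι.PreservesMonomorphisms :=
  (𝒢.component 1).preservesMonomorphisms_ι_of_isNormalEpiCategory

instance : (𝒢.component 1).ι.PreservesEpimorphisms :=
  (𝒢.component 1).preservesEpimorphisms_ι_of_isNormalMonoCategory

theorem mono_hom {X Y : 𝒢.NeutralComponent} (f : X ⟶ Y) [Mono f] : Mono f.hom :=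
  inferInstanceAs (Mono ((𝒢.component 1).ι.map f))

theorem epi_hom {X Y : 𝒢.NeutralComponent} (f : X ⟶ Y) [Epi f] : Epi f.hom :=
  inferInstanceAs (Epi ((𝒢.component 1).ι.map f))

theorem mono_of_mono_hom {X Y : 𝒢.NeutralComponent} (f : X ⟶ Y) [h : Mono f.hom] : Mono f :=
  (𝒢.component 1).ι.mono_of_mono_map h

theorem epi_of_epi_hom {X Y : 𝒢.NeutralComponent} (f : X ⟶ Y) [h : Epi f.hom] : Epi f :=
  (𝒢.component 1).ι.epi_of_epi_map h

theorem simple_obj_iff (X : 𝒢.NeutralComponent) : Simple X.obj ↔ Simple X := by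
  refine ⟨fun h => ?_, fun h => ⟨fun {Y} f _ => ?_⟩⟩
  · have : Simple ((𝒢.component 1).ι.obj X) := h
    exact (𝒢.component 1).ι.simple_of_simple_obj X
  -- A subobject in `C` of a degree-`1` object has degree `1` again, so it is already tested in the
  -- neutral component.
  · let Y' : 𝒢.NeutralComponent := ⟨Y, (𝒢.component 1).prop_of_mono f X.property⟩
    let f' : Y' ⟶ X := ObjectProperty.homMk f
    have : Mono f'.hom := inferInstanceAs (Mono f)
    have := 𝒢.mono_of_mono_hom f'
    have h1 : IsIso f' ↔ IsIso f := (isIso_iff_of_reflects_iso f' (𝒢.component 1).ι).symm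
    rw [← h1, Simple.mono_isIso_iff_nonzero, not_iff_not]
    exact ⟨fun h => congrArg (fun t => t.hom) h, fun h => ObjectProperty.hom_ext _ h⟩

theorem projective_obj_iff (X : 𝒢.NeutralComponent) : Projective X.obj ↔ Projective X := by
  refine ⟨fun h => ⟨fun {E B} f e _ => ?_⟩, fun h => ⟨fun {E B} f e _ => ?_⟩⟩
  · have := 𝒢.epi_hom e
    exact ⟨ObjectProperty.homMk (Projective.factorThru f.hom e.hom),
      ObjectProperty.hom_ext _ (Projective.factorThru_comp f.hom e.hom)⟩
  · obtain ⟨Y, _, hY, ⟨a⟩⟩ := 𝒢.exists_decomposition E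
    obtain ⟨Z, _, hZ, ⟨b⟩⟩ := 𝒢.exists_decomposition B
    -- The degree-`1` block of `e`. It is epi because the other summands of `E` have no nonzero maps
    -- to `Z 1`; lifting along it suffices because `X` has no nonzero maps to the other summands of
    -- `B`.
    let c : Y 1 ⟶ Z 1 := (biproduct.ι Y 1 ≫ a.inv) ≫ e ≫ b.hom ≫ biproduct.π Z 1
    have : Epi c := Preadditive.epi_of_cancel_zero _ fun t ht => by
      have : a.inv ≫ (e ≫ b.hom ≫ biproduct.π Z 1) ≫ t = 0 := by
        refine biproduct.hom_ext' _ _ fun g => ?_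
        by_cases hg : g = 1
        · subst hg
          simpa [c] using ht
        · have := 𝒢.hom_eq_zero hg (hY g) (hZ 1)
            (biproduct.ι Y g ≫ a.inv ≫ e ≫ b.hom ≫ biproduct.π Z 1)
          rw [comp_zero, ← zero_comp (f := t), ← this]
          simp only [Category.assoc]
      rw [Preadditive.IsIso.comp_left_eq_zero] at this
      rwa [← cancel_epi (e ≫ b.hom ≫ biproduct.π Z 1), comp_zero]
    let c' : (⟨Y 1, hY 1⟩ : 𝒢.NeutralComponent) ⟶ ⟨Z 1, hZ 1⟩ := ObjectProperty.homMk c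
    have : Epi c'.hom := inferInstanceAs (Epi c)
    have := 𝒢.epi_of_epi_hom c'
    let f' : X ⟶ (⟨Z 1, hZ 1⟩ : 𝒢.NeutralComponent) :=
      ObjectProperty.homMk (f ≫ b.hom ≫ biproduct.π Z 1)
    let l := Projective.factorThru f' c'
    have hl : l.hom ≫ c = f ≫ b.hom ≫ biproduct.π Z 1 :=
      congrArg (fun t => t.hom) (Projective.factorThru_comp f' c')
    refine ⟨l.hom ≫ biproduct.ι Y 1 ≫ a.inv, ?_⟩
    rw [← cancel_mono b.hom]
    refine biproduct.hom_ext _ _ fun g => ?_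
    by_cases hg : g = 1
    · subst hg
      simpa [c] using hl
    · exact (𝒢.hom_eq_zero (Ne.symm hg) X.property (hZ g) _).trans
        (𝒢.hom_eq_zero (Ne.symm hg) X.property (hZ g) _).symm

/-- Subobjects of an object of the neutral component are the same in the neutral component and
in the whole category. -/
noncomputable def subobjectOrderIso (X : 𝒢.NeutralComponent) :
    Subobject X.obj ≃o Subobject X :=
  let F (p : Subobject X.obj) :
      (⟨(p : C), (𝒢.component 1).prop_of_mono p.arrow X.property⟩ : 𝒢.NeutralComponent) ⟶ X :=
    ObjectProperty.homMk p.arrow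
  have hF (p) : Mono (F p) :=
    have : Mono (F p).hom := inferInstanceAs (Mono p.arrow)
    𝒢.mono_of_mono_hom _
  let E : Subobject X.obj ↪o Subobject X :=
    OrderEmbedding.ofMapLEIff (fun p => Subobject.mk (F p)) fun p q =>
      ⟨fun h => Subobject.le_of_comm (Subobject.ofMkLEMk _ _ h).hom
          (congrArg (fun t => t.hom) (Subobject.ofMkLEMk_comp h)),
        fun h => Subobject.mk_le_mk_of_comm (ObjectProperty.homMk (Subobject.ofLE p q h))
          (ObjectProperty.hom_ext _ (Subobject.ofLE_arrow h))⟩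
  RelIso.ofSurjective E fun q => by
    obtain ⟨Z, f, _, rfl⟩ := Subobject.mk_surjective q
    have := 𝒢.mono_hom f
    exact ⟨Subobject.mk f.hom, Subobject.mk_eq_mk_of_comm _ _
      ((𝒢.component 1).isoMk (Subobject.underlyingIso f.hom))
      (ObjectProperty.hom_ext _ (Subobject.underlyingIso_hom_comp_eq_mk f.hom))⟩

theorem hasFiniteLength_neutralComponent (X : 𝒢.NeutralComponent) : HasFiniteLength X := by
  obtain ⟨s, hs, hs'⟩ :=
    (IsTensorCategory.isLocallyFinite (k := k) (C := C)).hasFiniteLength X.obj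
  let e := 𝒢.subobjectOrderIso X
  refine ⟨s.map ⟨e, fun {a b} h => (apply_covBy_apply_iff e).mpr h⟩, ?_, ?_⟩
  · rw [RelSeries.head_map, hs]
    exact e.map_bot
  · rw [RelSeries.last_map, hs']
    exact e.map_top

/-- A right dual in `C` of an object of the neutral component is a right dual in the neutral
component. -/
@[reducible]
noncomputable def hasRightDual_neutralComponent (X : 𝒢.NeutralComponent) [HasRightDual X.obj] :
    HasRightDual X where
  rightDual := ⟨X.objᘁ, by simpa using 𝒢.prop_of_exactPairing_left X.property⟩
  exact := @ExactPairing.ofFullyFaithful _ _ _ _ _ _ (𝒢.component 1).ι _ _ _ X _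
    (HasRightDual.exact (X := X.obj))

/-- A left dual in `C` of an object of the neutral component is a left dual in the neutral
component. -/
@[reducible]
noncomputable def hasLeftDual_neutralComponent (X : 𝒢.NeutralComponent) [HasLeftDual X.obj] :
    HasLeftDual X where
  leftDual := ⟨ᘁX.obj, by simpa using 𝒢.prop_of_exactPairing_right X.property⟩
  exact := @ExactPairing.ofFullyFaithful _ _ _ _ _ _ (𝒢.component 1).ι _ _ _ _ X
    (HasLeftDual.exact (Y := X.obj))

instance isTensorCategory_neutralComponent : IsTensorCategory k 𝒢.NeutralComponent := by
  have h : IsTensorCategory k C := inferInstance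
  have := h.monoidalPreadditive
  have := h.monoidalLinear
  obtain ⟨_⟩ := h.rigid
  exact
  { monoidalPreadditive := inferInstance
    monoidalLinear := inferInstance
    rigid := ⟨
      { rightDual X := 𝒢.hasRightDual_neutralComponent X
        leftDual X := 𝒢.hasLeftDual_neutralComponent X }⟩
    isLocallyFinite :=
      { hasFiniteLength := 𝒢.hasFiniteLength_neutralComponent
        finiteDimensional_hom X Y :=
          have : FiniteDimensional k ((𝒢.component 1).ι.obj X ⟶ (𝒢.component 1).ι.obj Y) :=
            h.isLocallyFinite.finiteDimensional_hom X.obj Y.obj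
          FiniteDimensional.of_injective ((𝒢.component 1).ι.mapLinearMap k (X := X) (Y := Y))
            (𝒢.component 1).ι.map_injective }
    simple_unit := (𝒢.simple_obj_iff _).mp h.simple_unit }

/-! ### Transfer of projectives, simple objects and semisimplicity -/

theorem enoughProjectives_neutralComponent [EnoughProjectives C] :
    EnoughProjectives 𝒢.NeutralComponent where
  presentation X := by
    obtain ⟨Y, _, hY, ⟨e⟩⟩ := 𝒢.exists_decomposition (Projective.over X.obj)
    let r : Retract (Y 1) (Projective.over X.obj) :=
      { i := biproduct.ι Y 1 ≫ e.inv
        r := e.hom ≫ biproduct.π Y 1 }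
    let P : 𝒢.NeutralComponent := ⟨Y 1, hY 1⟩
    let f : P ⟶ X := ObjectProperty.homMk (r.i ≫ Projective.π X.obj)
    -- Summands of degree other than `1` map to `X` by zero, so the degree-`1` summand alone still
    -- covers `X`.
    have hf : r.r ≫ f.hom = Projective.π X.obj := by
      rw [← cancel_epi e.inv]
      refine biproduct.hom_ext' _ _ fun g => ?_
      by_cases hg : g = 1
      · subst hg
        simp [r, f]
      · exact (𝒢.hom_eq_zero hg (hY g) X.property _).trans
          (𝒢.hom_eq_zero hg (hY g) X.property _).symm
    have : Epi (r.r ≫ f.hom) := by rw [hf]; infer_instance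
    have := epi_of_epi r.r f.hom
    exact ⟨{ p := P
             projective := (𝒢.projective_obj_iff P).mp r.projective
             f := f
             epi := 𝒢.epi_of_epi_hom f }⟩

theorem enoughProjectives_of_neutralComponent [EnoughProjectives 𝒢.NeutralComponent] :
    EnoughProjectives C := by
  obtain ⟨_⟩ := IsTensorCategory.rigid (k := k) (C := C)
  let f := Projective.π (𝟙_ 𝒢.NeutralComponent)
  have : Epi f.hom := 𝒢.epi_hom f
  have : Projective (Projective.over (𝟙_ 𝒢.NeutralComponent)).obj :=
    (𝒢.projective_obj_iff _).mpr inferInstance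
  exact enoughProjectives_of_epi_unit f.hom

theorem hasFinitelyManySimples_neutralComponent (h : HasFinitelyManySimples C) :
    HasFinitelyManySimples 𝒢.NeutralComponent := by
  obtain ⟨n, S, hS⟩ := h
  classical
  -- The unit is only a filler at indices where `S i` is not of degree `1`.
  refine ⟨n, fun i => if hi : 𝒢.component 1 (S i) then ⟨S i, hi⟩ else 𝟙_ _, fun X hX => ?_⟩
  obtain ⟨i, ⟨e⟩⟩ := hS X.obj ((𝒢.simple_obj_iff X).mpr hX)
  have hi : 𝒢.component 1 (S i) := (𝒢.component 1).prop_of_iso e X.property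
  refine ⟨i, ?_⟩
  beta_reduce
  rw [dif_pos hi]
  exact ⟨(𝒢.component 1).isoMk e⟩

/-- If the neutral component has finitely many simple objects, so has every component: for simple
objects `X`, `Y` of `C_g` the object `Y ⊗ Xᘁ` of `C_e` has a simple subobject `T`, and `Y` is a
quotient of `T ⊗ X`. -/
theorem exists_list_simples_component (h : HasFinitelyManySimples 𝒢.NeutralComponent) (g : G) :
    ∃ l : List C, ∀ Y : C, 𝒢.component g Y → Simple Y → ∃ S ∈ l, Nonempty (Y ≅ S) := by
  have hC : IsTensorCategory k C := inferInstance
  have := hC.monoidalPreadditive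
  have := hC.simple_unit
  obtain ⟨_⟩ := hC.rigid
  by_cases hg : ∃ X : C, 𝒢.component g X ∧ Simple X
  swap
  · exact ⟨[], fun Y hY hY' => (hg ⟨Y, hY, hY'⟩).elim⟩
  obtain ⟨X, hX, hX'⟩ := hg
  obtain ⟨n, S, hS⟩ := h
  choose l hl using fun i =>
    (hC.isLocallyFinite.hasFiniteLength ((S i).obj ⊗ X)).exists_list_simple_quotients
  refine ⟨(List.ofFn l).flatten, fun Y hY hY' => ?_⟩
  have hW : 𝒢.component 1 (Y ⊗ Xᘁ) := by
    simpa using 𝒢.tensor_mem hY (𝒢.prop_of_exactPairing_left (Y := Xᘁ) hX)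
  obtain ⟨T, f, hT, _⟩ := (hC.isLocallyFinite.hasFiniteLength (Y ⊗ Xᘁ)).exists_simple_mono
    fun h => Simple.not_isZero Y (isZero_of_isZero_tensor_rightDual (Simple.not_isZero X) h)
  obtain ⟨i, ⟨e⟩⟩ := hS ⟨T, (𝒢.component 1).prop_of_mono f hW⟩ ((𝒢.simple_obj_iff _).mp hT)
  -- The adjoint transpose `(S i).obj ⊗ X ⟶ Y` of the inclusion of `T`; it is nonzero because the
  -- inclusion is mono and `T` is nonzero.
  have hne : (tensorRightHomEquiv (S i).obj X Xᘁ Y).symm (e.inv.hom ≫ f) ≠ 0 := fun h0 => by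
    rw [Equiv.symm_apply_eq] at h0
    have h1 : e.inv.hom ≫ f = 0 := by
      rw [h0]
      simp [tensorRightHomEquiv]
    have h2 : f = 0 := by
      have h3 : e.hom.hom ≫ e.inv.hom = 𝟙 T := congrArg (fun t => t.hom) e.hom_inv_id
      rw [← Category.id_comp f, ← h3, Category.assoc, h1, comp_zero]
    exact id_nonzero T (by rw [← cancel_mono f, h2, comp_zero, comp_zero])
  obtain ⟨Z, hZ, hYZ⟩ := hl i Y _ hY' hne
  exact ⟨Z, List.mem_flatten_of_mem (List.mem_ofFn.mpr ⟨i, rfl⟩) hZ, hYZ⟩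

theorem hasFinitelyManySimples_of_neutralComponent [Finite G]
    (h : HasFinitelyManySimples 𝒢.NeutralComponent) : HasFinitelyManySimples C := by
  have := Fintype.ofFinite G
  choose l hl using 𝒢.exists_list_simples_component h
  refine hasFinitelyManySimples_of_list (Finset.univ.toList.flatMap l) fun X hX => ?_
  obtain ⟨g, hg⟩ := 𝒢.exists_component_of_simple X
  obtain ⟨S, hS, e⟩ := hl g X hg hX
  exact ⟨S, List.mem_flatMap.mpr ⟨g, by simp, hS⟩, e⟩

theorem isFiniteTensorCategory_iff [Finite G] :
    IsFiniteTensorCategory k C ↔ IsFiniteTensorCategory k 𝒢.NeutralComponent :=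
  ⟨fun ⟨_, _, h'⟩ => ⟨inferInstance, 𝒢.enoughProjectives_neutralComponent,
    𝒢.hasFinitelyManySimples_neutralComponent h'⟩, fun ⟨_, _, h'⟩ => ⟨inferInstance,
    𝒢.enoughProjectives_of_neutralComponent, 𝒢.hasFinitelyManySimples_of_neutralComponent h'⟩⟩

theorem isSemisimple_iff [EnoughProjectives C] [EnoughProjectives 𝒢.NeutralComponent] :
    IsSemisimple C ↔ IsSemisimple 𝒢.NeutralComponent := by
  -- Both sides become projectivity of the unit, an object the two categories share.
  rw [IsTensorCategory.isSemisimple_iff k, IsTensorCategory.isSemisimple_iff k,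
    ← 𝒢.projective_obj_iff]
  rfl

theorem isFusionCategory_iff [Finite G] :
    IsFusionCategory k C ↔ IsFusionCategory k 𝒢.NeutralComponent := by
  constructor
  · rintro ⟨h, hs⟩
    have h' := 𝒢.isFiniteTensorCategory_iff.mp h
    have := h.enoughProjectives
    have := h'.enoughProjectives
    exact ⟨h', 𝒢.isSemisimple_iff.mp hs⟩
  · rintro ⟨h', hs⟩
    have h := 𝒢.isFiniteTensorCategory_iff.mpr h'
    have := h.enoughProjectives
    have := h'.enoughProjectives
    exact ⟨h, 𝒢.isSemisimple_iff.mpr hs⟩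

end GroupGrading

end TensorCat

theorem corollary3p5 {k : Type*} [Field k] [IsAlgClosed k]
    {C : Type u} [Category.{v} C] [Abelian C] [Linear k C] [MonoidalCategory C]
    [TensorCat.IsTensorCategory k C]
    {G : Type*} [Group G] [Finite G] (𝒢 : TensorCat.GroupGrading k C G) :
    (TensorCat.IsFiniteTensorCategory k C ↔
      TensorCat.IsFiniteTensorCategory k 𝒢.NeutralComponent) ∧
    (TensorCat.IsFusionCategory k C ↔
      TensorCat.IsFusionCategory k 𝒢.NeutralComponent) :=
  ⟨𝒢.isFiniteTensorCategory_iff, 𝒢.isFusionCategory_iff⟩
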